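/- Let $d\ge 1$ be an integer, $\omega=e^{2\pi i/d}$, and write $\omega^z=e^{2\pi i z/d}$ for $z\in\mathbb C$. For $a=(a_1,\dots,a_{d-1})\in\mathbb C^{d-1}$ let $P_0(t)=-\frac1d t^d+\sum_{k=1}^{d-1}a_kt^k$. For $0\le k\le d-1$ and $\operatorname{Re}s>0$ put $$\Omega_k(s)=\Omega_k(s|a)=\int_0^{+\infty\cdot\omega^k}t^{s-1}e^{P_0(t)}\,dt ,$$ where the integral is taken along the ray $t=\omega^k u$, $u>0$, with $\arg t=2\pi k/d$, and denote by the same symbol its meromorphic extension to $\mathbb C$, which is holomorphic outside $\{0,-1,-2,\dots\}$ and is obtained from the functional equation $s\,\Omega_k(s)=\Omega_k(s+d)-\sum_{l=1}^{d-1}l\,a_l\,\Omega_k(s+l)$. Let $\Delta(s|a)=\det[\Omega_{k-1}(s+l)]_{1\le k,l\le d}$. 1. For all $a\in\mathbb C^{d-1}$ and $s\in\mathbb C\setminus\{-1,-2,\dots\}$, the vectors $(\Omega_k(s+l))_{0\le k\le d-1}$, $l=1,\dots,d$, are linearly independent over $\mathbb C$, and $\Delta(s|a)\neq0$. 2. There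 is a polynomial $\Pi_d\in\mathbb Q[s,a_1,\dots,a_{d-1}]$, depending only on $d$, such that $$\Delta(s|a)=\Delta(s|0)\,\exp\bigl(\Pi_d(s,a)\bigr)\qquad\text{for all }a\in\mathbb C^{d-1},\ s\in\mathbb C\setminus\{-1,-2,\dots\}.$$ 3. For all $s\in\mathbb C\setminus\{-1,-2,\dots\}$, $$\Delta(s|0)=(-i)^{\frac{(d-1)(d-2)}2}\,\frac{(2\pi)^{d/2}}{\sqrt{2\pi}}\;\omega^{\frac{d(d-1)}2s}\,s\,\Gamma(s),$$ where $s\,\Gamma(s)=\Gamma(s+1)$ is given its limit value $1$ at $s=0$. -/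

import Mathlib

open Complex MeasureTheory Set Filter Topology Asymptotics

noncomputable section

namespace OmegaFunction

/-- The power `ω ^ z` of `ω = exp (2πi/d)`, taken with `log ω = 2πi/d`. For a natural number `k`,
`omegaPow d k` is the root of unity `ω_k = ω ^ k`. -/
def omegaPow (d : ℕ) (z : ℂ) : ℂ :=
  Complex.exp (2 * (Real.pi : ℂ) * Complex.I / (d : ℂ) * z)

/-- The polynomial `P₀(t) = -(1/d) t^d + a₁ t + ⋯ + a_{d-1} t^{d-1}`;
the parameter `a_k` (`1 ≤ k ≤ d-1`) is the entry of `a` with index `k-1`. -/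
def P₀ (d : ℕ) (a : Fin (d - 1) → ℂ) : Polynomial ℂ :=
  Polynomial.C (-1 / (d : ℂ)) * Polynomial.X ^ d +
    ∑ i : Fin (d - 1), Polynomial.C (a i) * Polynomial.X ^ ((i : ℕ) + 1)

/-- The integral of `t ^ (s-1) e^{P₀(t)}` along the ray from `0` to `+∞·ω_k`, parametrised by
`t = ω_k u` with `u > 0`. The argument of `t` on this ray is `2πk/d`, so that
`t ^ (s-1) = ω ^ (k(s-1)) u ^ (s-1)`. -/
def rayIntegral (d : ℕ) (a : Fin (d - 1) → ℂ) (k : ℕ) (s : ℂ) : ℂ :=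
  ∫ u in Ioi (0 : ℝ),
    omegaPow d ((k : ℂ) * (s - 1)) * (u : ℂ) ^ (s - 1)
      * Complex.exp ((P₀ d a).eval (omegaPow d k * (u : ℂ))) * omegaPow d k

/-- The `n`-th step of the meromorphic extension: `extend d a k n` is the extension of the integral
to the half-plane `Re s > -n`, obtained by using `n` times the functional equation
`s Ω_k(s) = ∑_{l=1}^d α_l Ω_k(s+l)`, where `α_l = -l a_l` and `a_l` is the coefficient of `t^l`
in `P₀` (so `α_d = 1`). -/
def extend (d : ℕ) (a : Fin (d - 1) → ℂ) (k : ℕ) : ℕ → ℂ → ℂ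
  | 0, s => rayIntegral d a k s
  | n + 1, s =>
      (∑ l ∈ Finset.Icc 1 d, (-(l : ℂ) * (P₀ d a).coeff l) * extend d a k n (s + (l : ℂ))) / s

/-- The Omega function `Ω_k(s | a₁, …, a_{d-1})` on the complex plane. It is the integral over the
ray if `Re s > 0`; elsewhere the least number `n` of extension steps with `Re s > -n` is used.
The theorems `Omega_eq_rayIntegral` and `Omega_differentiableAt` below show that this is the
analytic continuation of the integral to the complement of `{0, -1, -2, …}`. -/
def Omega (d : ℕ) (a : Fin (d - 1) → ℂ) (k : ℕ) (s : ℂ) : ℂ :=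
  extend d a k (⌊-s.re⌋ + 1).toNat s

/-- The `d × d` matrix with entries `Ω_{k-1}(s + l)`, `1 ≤ k, l ≤ d`
(row and column indices are shifted by one, since `Fin d` starts at `0`). -/
def omegaMatrix (d : ℕ) (a : Fin (d - 1) → ℂ) (s : ℂ) : Matrix (Fin d) (Fin d) ℂ :=
  Matrix.of fun k l => Omega d a (k : ℕ) (s + ((l : ℕ) : ℂ) + 1)

/-- The determinant `Δ(s | a₁, …, a_{d-1})`. -/
def Delta (d : ℕ) (a : Fin (d - 1) → ℂ) (s : ℂ) : ℂ :=
  (omegaMatrix d a s).det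

theorem P₀_natDegree_le (d : ℕ) (a : Fin (d - 1) → ℂ) : (P₀ d a).natDegree ≤ d := by
  unfold P₀
  refine Polynomial.natDegree_add_le_of_degree_le (Polynomial.natDegree_C_mul_X_pow_le _ _) ?_
  refine Polynomial.natDegree_sum_le_of_forall_le _ _ fun i _ => ?_
  refine (Polynomial.natDegree_C_mul_X_pow_le _ _).trans ?_
  have := i.2
  omega

theorem P₀_coeff_zero (d : ℕ) (hd : 1 ≤ d) (a : Fin (d - 1) → ℂ) : (P₀ d a).coeff 0 = 0 := by
  have : d ≠ 0 := by omega
  simp [P₀, this.symm, Polynomial.coeff_X_pow]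

theorem omegaPow_add (d : ℕ) (z w : ℂ) : omegaPow d (z + w) = omegaPow d z * omegaPow d w := by
  simp [omegaPow, mul_add, Complex.exp_add]

theorem omegaPow_mul_nat (d : ℕ) (z : ℂ) (n : ℕ) :
    omegaPow d (z * n) = omegaPow d z ^ n := by
  rw [omegaPow, omegaPow, ← Complex.exp_nat_mul]
  ring_nf

theorem omegaPow_pow_self (d : ℕ) (hd : 1 ≤ d) (k : ℕ) : omegaPow d k ^ d = 1 := by
  have : (d : ℂ) ≠ 0 := by exact_mod_cast (by omega : d ≠ 0)
  rw [← omegaPow_mul_nat, omegaPow, Complex.exp_eq_one_iff]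
  refine ⟨k, ?_⟩
  push_cast
  field_simp

/-- The exponential factor on the `k`-th ray. -/
def rayExp (d : ℕ) (a : Fin (d - 1) → ℂ) (k : ℕ) (u : ℝ) : ℂ :=
  Complex.exp ((P₀ d a).eval (omegaPow d k * (u : ℂ)))

theorem rayExp_continuous (d : ℕ) (a : Fin (d - 1) → ℂ) (k : ℕ) : Continuous (rayExp d a k) := by
  unfold rayExp
  fun_prop

theorem rayExp_isBigO (d : ℕ) (hd : 1 ≤ d) (a : Fin (d - 1) → ℂ) (k : ℕ) :
    rayExp d a k =O[atTop] fun u : ℝ => Real.exp (-(1 / (2 * (d : ℝ))) * u) := by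
  have hd0 : (0 : ℝ) < d := by exact_mod_cast hd
  have hlow : (fun u : ℝ => ∑ i : Fin (d - 1), a i * (omegaPow d k * (u : ℂ)) ^ ((i : ℕ) + 1))
      =o[atTop] fun u : ℝ => u ^ d := by
    refine IsLittleO.fun_sum fun i _ => ?_
    have hi : (i : ℕ) + 1 < d := by have := i.2; omega
    have h1 : (fun u : ℝ => u ^ ((i : ℕ) + 1)) =o[atTop] fun u : ℝ => u ^ d :=
      isLittleO_pow_pow_atTop_of_lt hi
    refine (IsBigO.of_bound ‖a i * omegaPow d k ^ ((i : ℕ) + 1)‖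
      (Eventually.of_forall fun u => ?_)).trans_isLittleO h1
    simp [mul_pow, mul_assoc]
  refine IsBigO.of_bound 1 ?_
  filter_upwards [hlow.bound (show (0 : ℝ) < 1 / (2 * d) by positivity), eventually_ge_atTop 1]
    with u hu hu1
  rw [rayExp, Complex.norm_exp, Real.norm_of_nonneg (Real.exp_pos _).le, one_mul,
    Real.exp_le_exp]
  have hev : (P₀ d a).eval (omegaPow d k * (u : ℂ)) = ((-(1 / d) * u ^ d : ℝ) : ℂ) +
      ∑ i : Fin (d - 1), a i * (omegaPow d k * (u : ℂ)) ^ ((i : ℕ) + 1) := by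
    simp only [P₀, Polynomial.eval_add, Polynomial.eval_finsetSum, Polynomial.eval_mul,
      Polynomial.eval_C, Polynomial.eval_pow, Polynomial.eval_X]
    rw [mul_pow, omegaPow_pow_self d hd]
    push_cast
    ring
  rw [hev, Complex.add_re, Complex.ofReal_re]
  have h2 := (Complex.re_le_norm _).trans hu
  have h3 : u ≤ u ^ d := le_self_pow₀ hu1 (by omega)
  rw [Real.norm_of_nonneg (by positivity)] at h2
  have h4 : 1 / (2 * (d : ℝ)) * u ≤ 1 / (2 * d) * u ^ d := by gcongr
  have h5 : (1 : ℝ) / d = 2 * (1 / (2 * d)) := by field_simp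
  rw [h5]
  linarith

theorem rayExp_isBigO_zero (d : ℕ) (a : Fin (d - 1) → ℂ) (k : ℕ) :
    rayExp d a k =O[𝓝[>] 0] fun u : ℝ => u ^ (-(0 : ℝ)) := by
  simpa using ((rayExp_continuous d a k).tendsto 0).mono_left nhdsWithin_le_nhds |>.isBigO_one ℝ

theorem rayExp_locallyIntegrableOn (d : ℕ) (a : Fin (d - 1) → ℂ) (k : ℕ) :
    LocallyIntegrableOn (rayExp d a k) (Ioi 0) :=
  (rayExp_continuous d a k).locallyIntegrable.locallyIntegrableOn _

theorem rayExp_mellinConvergent (d : ℕ) (hd : 1 ≤ d) (a : Fin (d - 1) → ℂ) (k : ℕ) {s : ℂ}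
    (hs : 0 < s.re) : MellinConvergent (rayExp d a k) s := by
  have hd0 : (0 : ℝ) < d := by exact_mod_cast hd
  exact mellinConvergent_of_isBigO_rpow_exp (by positivity) (rayExp_locallyIntegrableOn d a k)
    (rayExp_isBigO d hd a k) (rayExp_isBigO_zero d a k) hs

theorem rayIntegral_eq (d : ℕ) (a : Fin (d - 1) → ℂ) (k : ℕ) (s : ℂ) :
    rayIntegral d a k s = omegaPow d (k * s) * mellin (rayExp d a k) s := by
  rw [rayIntegral, mellin, ← integral_const_mul]
  congr 1
  ext u
  have : omegaPow d (k * s) = omegaPow d (k * (s - 1)) * omegaPow d k := by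
    rw [← omegaPow_add]; ring_nf
  rw [this, rayExp, smul_eq_mul]
  ring

theorem rayIntegral_differentiableAt (d : ℕ) (hd : 1 ≤ d) (a : Fin (d - 1) → ℂ) (k : ℕ) {s : ℂ}
    (hs : 0 < s.re) : DifferentiableAt ℂ (rayIntegral d a k) s := by
  have hd0 : (0 : ℝ) < d := by exact_mod_cast hd
  have h : rayIntegral d a k = fun s => omegaPow d (k * s) * mellin (rayExp d a k) s :=
    funext (rayIntegral_eq d a k)
  rw [h]
  refine DifferentiableAt.mul (by unfold omegaPow; fun_prop) ?_
  exact mellin_differentiableAt_of_isBigO_rpow_exp (by positivity)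
    (rayExp_locallyIntegrableOn d a k) (rayExp_isBigO d hd a k) (rayExp_isBigO_zero d a k) hs

theorem eval_derivative_P₀ (d : ℕ) (a : Fin (d - 1) → ℂ) (t : ℂ) :
    t * (P₀ d a).derivative.eval t =
      ∑ l ∈ Finset.Icc 1 d, ((l : ℂ) * (P₀ d a).coeff l) * t ^ l := by
  rw [Polynomial.derivative_eval, Polynomial.sum_over_range' _ (by simp) (d + 1)
    (Nat.lt_succ_of_le (P₀_natDegree_le d a)), Finset.sum_range_succ']
  have h : Finset.Icc 1 d = (Finset.range d).map (addRightEmbedding 1) := by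
    ext x; simp only [Finset.mem_Icc, Finset.mem_map, Finset.mem_range, addRightEmbedding_apply]
    exact ⟨fun h => ⟨x - 1, by omega, by omega⟩, by rintro ⟨y, hy, rfl⟩; omega⟩
  rw [h, Finset.sum_map]
  simp only [Nat.cast_zero, mul_zero, zero_mul, add_zero, Finset.mul_sum, addRightEmbedding_apply]
  refine Finset.sum_congr rfl fun i _ => ?_
  rw [Nat.add_sub_cancel, pow_succ]
  ring

/-- The functional equation on the half-plane `Re s > 0`. -/
theorem rayIntegral_functional (d : ℕ) (hd : 1 ≤ d) (a : Fin (d - 1) → ℂ) (k : ℕ) {s : ℂ}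
    (hs : 0 < s.re) :
    s * rayIntegral d a k s = ∑ l ∈ Finset.Icc 1 d,
      (-(l : ℂ) * (P₀ d a).coeff l) * rayIntegral d a k (s + (l : ℂ)) := by
  have hd0 : (0 : ℝ) < d := by exact_mod_cast hd
  have hs0 : s ≠ 0 := by rintro rfl; simp at hs
  set w := omegaPow d k with hw
  set g := rayExp d a k with hg
  have hconv : ∀ l : ℕ, MellinConvergent g (s + (l : ℂ)) := fun l =>
    rayExp_mellinConvergent d hd a k (by simp; positivity)
  have hconv0 : MellinConvergent g s := rayExp_mellinConvergent d hd a k hs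
  have hderiv : ∀ u ∈ Ioi (0 : ℝ), HasDerivAt (fun u : ℝ => (u : ℂ) ^ s * g u)
      (s * ((u : ℂ) ^ (s - 1) • g u) + ∑ l ∈ Finset.Icc 1 d,
        ((l : ℂ) * (P₀ d a).coeff l * w ^ l) * ((u : ℂ) ^ (s + (l : ℂ) - 1) • g u)) u := by
    intro u hu
    have hu0 : (u : ℂ) ≠ 0 := by exact_mod_cast (ne_of_gt hu)
    have h1 : HasDerivAt (fun u : ℝ => (u : ℂ) ^ s) (s * (u : ℂ) ^ (s - 1)) u := by
      have := (hasDerivAt_ofReal_cpow_const' (x := u) (r := s - 1) (ne_of_gt hu)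
        (by intro h; apply hs0; linear_combination h)).const_mul s
      simp only [sub_add_cancel] at this
      have heq : (fun y : ℝ => s * ((y : ℂ) ^ s / s)) = fun y : ℝ => (y : ℂ) ^ s :=
        funext fun y => by field_simp
      rwa [heq] at this
    have h2 : HasDerivAt g (g u * ((P₀ d a).derivative.eval (w * (u : ℂ)) * w)) u := by
      have hlin : HasDerivAt (fun y : ℝ => w * (y : ℂ)) w u := by
        simpa using (Complex.ofRealCLM.hasDerivAt (x := u)).const_mul w
      have := (((P₀ d a).hasDerivAt (w * (u : ℂ))).comp u hlin).cexp
      exact this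
    refine (h1.mul h2).congr_deriv ?_
    have h3 := eval_derivative_P₀ d a (w * (u : ℂ))
    have h4 : (u : ℂ) ^ s = (u : ℂ) ^ (s - 1) * u := by
      rw [Complex.cpow_sub _ _ hu0, Complex.cpow_one]; field_simp
    have h5 : ∀ l : ℕ, (u : ℂ) ^ (s + (l : ℂ) - 1) = (u : ℂ) ^ (s - 1) * (u : ℂ) ^ l := by
      intro l
      rw [← Complex.cpow_natCast, ← Complex.cpow_add _ _ hu0]; ring_nf
    have h6 : ∑ l ∈ Finset.Icc 1 d,
        ((l : ℂ) * (P₀ d a).coeff l * w ^ l) * ((u : ℂ) ^ (s + (l : ℂ) - 1) • g u) =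
        (u : ℂ) ^ (s - 1) * g u * (w * u * (P₀ d a).derivative.eval (w * (u : ℂ))) := by
      rw [h3, Finset.mul_sum]
      refine Finset.sum_congr rfl fun l _ => ?_
      rw [h5, smul_eq_mul]; ring
    rw [h6, h4, smul_eq_mul]
    ring
  have hint0 : IntegrableOn (fun u : ℝ => s * ((u : ℂ) ^ (s - 1) • g u)) (Ioi 0) :=
    hconv0.const_mul s
  have hintl : ∀ l ∈ Finset.Icc 1 d, IntegrableOn (fun u : ℝ =>
      ((l : ℂ) * (P₀ d a).coeff l * w ^ l) * ((u : ℂ) ^ (s + (l : ℂ) - 1) • g u)) (Ioi 0) :=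
    fun l _ => (hconv l).const_mul _
  have hcont : ContinuousWithinAt (fun u : ℝ => (u : ℂ) ^ s * g u) (Ici 0) 0 := by
    refine ContinuousAt.continuousWithinAt (ContinuousAt.mul ?_
      (rayExp_continuous d a k).continuousAt)
    exact Complex.continuousAt_ofReal_cpow_const 0 s (Or.inl hs)
  have hlim : Tendsto (fun u : ℝ => (u : ℂ) ^ s * g u) atTop (𝓝 0) := by
    have h1 : (fun u : ℝ => (u : ℂ) ^ s) =O[atTop] fun u : ℝ => u ^ s.re := by
      refine IsBigO.of_bound 1 ?_
      filter_upwards [eventually_gt_atTop 0] with u hu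
      rw [Complex.norm_cpow_eq_rpow_re_of_pos hu, one_mul]
      exact le_abs_self _
    refine (h1.mul (rayExp_isBigO d hd a k)).trans_tendsto ?_
    exact tendsto_rpow_mul_exp_neg_mul_atTop_nhds_zero s.re _ (by positivity)
  have hmain := integral_Ioi_of_hasDerivAt_of_tendsto hcont hderiv
    (hint0.add (integrable_finsetSum _ hintl)) hlim
  rw [integral_add hint0 (integrable_finsetSum _ hintl), integral_finsetSum _ hintl] at hmain
  simp only [integral_const_mul, Complex.ofReal_zero, Complex.zero_cpow hs0, zero_mul,
    sub_zero] at hmain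
  change s * mellin g s + ∑ l ∈ Finset.Icc 1 d,
    ((l : ℂ) * (P₀ d a).coeff l * w ^ l) * mellin g (s + (l : ℂ)) = 0 at hmain
  have hR : ∀ l ∈ Finset.Icc 1 d,
      (-(l : ℂ) * (P₀ d a).coeff l) * rayIntegral d a k (s + (l : ℂ)) = -(omegaPow d (k * s) *
        (((l : ℂ) * (P₀ d a).coeff l * w ^ l) * mellin g (s + (l : ℂ)))) := by
    intro l _
    rw [rayIntegral_eq, mul_add, omegaPow_add, omegaPow_mul_nat]
    ring
  rw [Finset.sum_congr rfl hR, Finset.sum_neg_distrib, ← Finset.mul_sum, rayIntegral_eq]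
  linear_combination omegaPow d (k * s) * hmain

theorem extend_succ_eq (d : ℕ) (hd : 1 ≤ d) (a : Fin (d - 1) → ℂ) (k : ℕ) (n : ℕ) :
    ∀ s : ℂ, -(n : ℝ) < s.re → extend d a k (n + 1) s = extend d a k n s := by
  induction n with
  | zero =>
    intro s hs
    have hs' : 0 < s.re := by simpa using hs
    have hs0 : s ≠ 0 := by rintro rfl; simp at hs'
    change _ / s = rayIntegral d a k s
    rw [div_eq_iff hs0, mul_comm]
    exact (rayIntegral_functional d hd a k hs').symm
  | succ n ih =>
    intro s hs
    rw [extend]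
    conv_rhs => rw [extend]
    congr 1
    refine Finset.sum_congr rfl fun l hl => ?_
    rw [ih]
    have h1 : (1 : ℝ) ≤ l := by exact_mod_cast (Finset.mem_Icc.1 hl).1
    simp only [Complex.add_re, Complex.natCast_re]
    push_cast at hs
    linarith

theorem extend_eq_of_le (d : ℕ) (hd : 1 ≤ d) (a : Fin (d - 1) → ℂ) (k : ℕ) {n m : ℕ}
    (hnm : n ≤ m) {s : ℂ} (hs : -(n : ℝ) < s.re) : extend d a k m s = extend d a k n s := by
  induction m, hnm using Nat.le_induction with
  | base => rfl
  | succ m hm ih =>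
    rw [extend_succ_eq d hd a k m s, ih]
    have : (n : ℝ) ≤ m := by exact_mod_cast hm
    linarith

theorem extend_differentiableAt (d : ℕ) (hd : 1 ≤ d) (a : Fin (d - 1) → ℂ) (k : ℕ) (n : ℕ) :
    ∀ s : ℂ, -(n : ℝ) < s.re → (∀ m : ℕ, s ≠ -(m : ℂ)) →
      DifferentiableAt ℂ (extend d a k n) s := by
  induction n with
  | zero =>
    intro s hs _
    exact rayIntegral_differentiableAt d hd a k (by simpa using hs)
  | succ n ih =>
    intro s hs hm
    have h : extend d a k (n + 1) = fun s => (∑ l ∈ Finset.Icc 1 d,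
      (-(l : ℂ) * (P₀ d a).coeff l) * extend d a k n (s + (l : ℂ))) / s := by
      ext s; rw [extend]
    rw [h]
    refine DifferentiableAt.div ?_ differentiableAt_id (by simpa using hm 0)
    refine DifferentiableAt.fun_sum fun l hl => DifferentiableAt.const_mul ?_ _
    have h1 : (1 : ℝ) ≤ l := by exact_mod_cast (Finset.mem_Icc.1 hl).1
    have h2 : DifferentiableAt ℂ (extend d a k n) (s + (l : ℂ)) := by
      refine ih _ ?_ fun m h => hm (m + l) ?_
      · simp only [Complex.add_re, Complex.natCast_re]
        push_cast at hs
        linarith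
      · push_cast; linear_combination h
    exact h2.comp s (differentiableAt_id.add_const _)

theorem Omega_eq_extend (d : ℕ) (hd : 1 ≤ d) (a : Fin (d - 1) → ℂ) (k : ℕ) {n : ℕ} {s : ℂ}
    (hs : -(n : ℝ) < s.re) : Omega d a k s = extend d a k n s := by
  rw [Omega]
  refine (extend_eq_of_le d hd a k ?_ ?_).symm
  · have : ⌊-s.re⌋ < (n : ℤ) := by
      rw [Int.floor_lt]; push_cast; linarith
    omega
  · have h1 := Int.lt_floor_add_one (-s.re)
    have h2 : (((⌊-s.re⌋ + 1 : ℤ)) : ℝ) ≤ (((⌊-s.re⌋ + 1).toNat : ℤ) : ℝ) := by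
      exact_mod_cast Int.self_le_toNat _
    push_cast at h2
    linarith

/-- For `Re s > 0` the Omega function is given by the integral over the ray. -/
theorem Omega_eq_rayIntegral (d : ℕ) (a : Fin (d - 1) → ℂ) (k : ℕ) {s : ℂ} (hs : 0 < s.re) :
    Omega d a k s = rayIntegral d a k s := by
  have h : (⌊-s.re⌋ + 1).toNat = 0 := by
    have : ⌊-s.re⌋ < 0 := by rw [Int.floor_lt]; simpa using hs
    omega
  rw [Omega, h, extend]

/-- The Omega functions are holomorphic on the complement of `{0, -1, -2, …}`. -/
theorem Omega_differentiableAt (d : ℕ) (hd : 1 ≤ d) (a : Fin (d - 1) → ℂ) (k : ℕ) {s : ℂ}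
    (hs : ∀ m : ℕ, s ≠ -(m : ℂ)) : DifferentiableAt ℂ (Omega d a k) s := by
  obtain ⟨n, hn⟩ := exists_nat_gt (-s.re)
  have hn' : -(n : ℝ) < s.re := by linarith
  refine (extend_differentiableAt d hd a k n s hn' hs).congr_of_eventuallyEq ?_
  have hopen : {z : ℂ | -(n : ℝ) < z.re} ∈ 𝓝 s :=
    (isOpen_lt continuous_const Complex.continuous_re).mem_nhds hn'
  filter_upwards [hopen] with z hz using Omega_eq_extend d hd a k hz

end OmegaFunction

end

/-!
The determinant is followed along the rays `τ ↦ τ a` in parameter space, down to `a = 0`, where it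
is computed explicitly.

*Dependence on the parameters.* Differentiation under the integral sign gives
`∂Ω_k(s) / ∂a_l = Ω_k(s + l)` for `Re s > 0`, and the functional equation carries this over to all
`s` outside the poles (`hasDerivAt_Omega_smul`). The functional equation also expresses every
`Ω_k(s + n + 1)` through `Ω_k(s + 1), …, Ω_k(s + d)`, with coefficients which are polynomials in
`s` and `a` over `ℚ` and do not depend on `k` (`exists_reduction_coeff`). Hence along the ray the
matrix `W` of the `Ω_k(s + l)` satisfies `W' = W M` with `M` polynomial in `s` and `τ a`, and
Jacobi's formula gives `Δ' = (tr M) Δ`. The trace has a primitive in `τ`, whose value at `τ = 1` is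
a polynomial over `ℚ` in `s` and `a` (`exists_primitive_along_ray`); this is the exponent in
`exists_Delta_eq_mul_exp`.

*The value at `a = 0`.* There `Ω_k(s) = ω^{ks} d^{s/d-1} Γ(s/d)` (`Omega_zero_eq`), so the
determinant is a product of Gamma factors times the Vandermonde determinant of the `d`-th roots of
unity. The first is evaluated by the Gauss multiplication formula `prod_Gamma_add_div`, obtained
from Euler's limit for `Γ`, with the constant supplied by Stirling's formula. For the second
(`det_vandermonde_omegaPow`), the modulus follows from the orthogonality of the rows, and the phase
from writing each difference of roots of unity as an explicit phase times a positive sine.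

The value at `a = 0` does not vanish, since `Γ(s + 1)` has no zeros, and neither does an
exponential; this gives the linear independence.
-/

namespace OmegaFunction

/-! ### The functional equation and the dependence on the parameters -/


theorem P₀_coeff_self (d : ℕ) (hd : 1 ≤ d) (a : Fin (d - 1) → ℂ) :
    (P₀ d a).coeff d = -1 / (d : ℂ) := by
  have h : ∑ i : Fin (d - 1), (if d = (i : ℕ) + 1 then a i else 0) = 0 :=
    Finset.sum_eq_zero fun i _ => if_neg (by have := i.2; omega)
  simp [P₀, Polynomial.coeff_X_pow, h]

theorem P₀_coeff_succ (d : ℕ) (a : Fin (d - 1) → ℂ) (i : Fin (d - 1)) :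
    (P₀ d a).coeff ((i : ℕ) + 1) = a i := by
  have h : (i : ℕ) + 1 ≠ d := by have := i.2; omega
  simp [P₀, Polynomial.coeff_X_pow, h, Fin.val_inj]

/-- Splitting off the top term of a sum over `1 ≤ l ≤ d`. -/
theorem sum_Icc_eq_add_sum_fin (d : ℕ) (hd : 1 ≤ d) (f : ℕ → ℂ) :
    ∑ l ∈ Finset.Icc 1 d, f l = f d + ∑ i : Fin (d - 1), f ((i : ℕ) + 1) := by
  obtain ⟨m, rfl⟩ : ∃ m, d = m + 1 := ⟨d - 1, by omega⟩
  rw [Finset.sum_Icc_succ_top (by omega), add_comm, Nat.add_sub_cancel,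
    Fin.sum_univ_eq_sum_range (fun i => f (i + 1)), Finset.range_eq_Ico, Finset.sum_Ico_add']
  rfl

/-- The functional equation for all `s ≠ 0`. It holds even where a term has a pole, because the
values of `Omega` there come from the same recursion. -/
theorem Omega_functional (d : ℕ) (hd : 1 ≤ d) (a : Fin (d - 1) → ℂ) (k : ℕ) {s : ℂ}
    (hs : s ≠ 0) :
    s * Omega d a k s = Omega d a k (s + d) -
      ∑ i : Fin (d - 1), (((i : ℕ) : ℂ) + 1) * a i * Omega d a k (s + ((i : ℕ) : ℂ) + 1) := by
  obtain ⟨n, hn⟩ := exists_nat_gt (-s.re)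
  have hl : ∀ l ∈ Finset.Icc 1 d, extend d a k n (s + (l : ℂ)) = Omega d a k (s + (l : ℂ)) :=
    fun l _ => (Omega_eq_extend d hd a k (by
      have : (0 : ℝ) ≤ l := l.cast_nonneg
      simp only [add_re, natCast_re]; linarith)).symm
  rw [Omega_eq_extend d hd a k (n := n + 1) (s := s) (by push_cast; linarith), extend,
    mul_div_cancel₀ _ hs, Finset.sum_congr rfl fun l h => by rw [hl l h],
    sum_Icc_eq_add_sum_fin d hd, P₀_coeff_self d hd]
  have hd0 : (d : ℂ) ≠ 0 := by exact_mod_cast (by omega : d ≠ 0)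
  rw [show -(d : ℂ) * (-1 / d) = 1 by field_simp, one_mul, sub_eq_add_neg,
    ← Finset.sum_neg_distrib]
  congr 1
  refine Finset.sum_congr rfl fun i _ => ?_
  rw [P₀_coeff_succ]
  push_cast
  rw [add_assoc]
  ring

theorem eval_P₀ (d : ℕ) (a : Fin (d - 1) → ℂ) (x : ℂ) :
    (P₀ d a).eval x = -1 / (d : ℂ) * x ^ d + ∑ i : Fin (d - 1), a i * x ^ ((i : ℕ) + 1) := by
  simp [P₀, Polynomial.eval_finsetSum]

theorem eval_P₀_smul (d : ℕ) (a : Fin (d - 1) → ℂ) (τ x : ℂ) :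
    (P₀ d (τ • a)).eval x =
      -1 / (d : ℂ) * x ^ d + τ * ∑ i : Fin (d - 1), a i * x ^ ((i : ℕ) + 1) := by
  simp [eval_P₀, Finset.mul_sum, mul_assoc]

theorem norm_omegaPow_natCast (d k : ℕ) : ‖omegaPow d k‖ = 1 := by
  rw [omegaPow, show 2 * (Real.pi : ℂ) * I / (d : ℂ) * k = ((2 * Real.pi / d * k : ℝ) : ℂ) * I by
    push_cast; ring]
  exact norm_exp_ofReal_mul_I _

/-- On every ray the exponential factor is dominated, locally uniformly in the scale `τ` of the
parameters, by the one on the positive real axis with positive parameters. -/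
theorem norm_rayExp_smul_le (d : ℕ) (hd : 1 ≤ d) (a : Fin (d - 1) → ℂ) (k : ℕ) {τ : ℂ} {R : ℝ}
    (hτ : ‖τ‖ ≤ R) {u : ℝ} (hu : 0 ≤ u) :
    ‖rayExp d (τ • a) k u‖ ≤ ‖rayExp d (fun i => ((R * ‖a i‖ : ℝ) : ℂ)) 0 u‖ := by
  have hw := norm_omegaPow_natCast d k
  have h0 : omegaPow d (0 : ℕ) = 1 := by simp [omegaPow]
  rw [rayExp, rayExp, norm_exp, norm_exp, Real.exp_le_exp, eval_P₀_smul, eval_P₀, h0, mul_pow,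
    omegaPow_pow_self d hd, one_mul, one_mul, add_re, add_re]
  refine add_le_add le_rfl ?_
  have hR : (∑ i : Fin (d - 1), ((R * ‖a i‖ : ℝ) : ℂ) * (u : ℂ) ^ ((i : ℕ) + 1)).re =
      R * ∑ i : Fin (d - 1), ‖a i‖ * u ^ ((i : ℕ) + 1) := by
    rw [Finset.mul_sum, re_sum]
    refine Finset.sum_congr rfl fun i _ => ?_
    rw [← ofReal_pow, ← ofReal_mul, ofReal_re, mul_assoc]
  rw [hR]
  refine (re_le_norm _).trans ?_
  rw [norm_mul]
  refine mul_le_mul hτ ((norm_sum_le _ _).trans (Finset.sum_le_sum fun i _ => ?_)) (norm_nonneg _)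
    ((norm_nonneg _).trans hτ)
  rw [norm_mul, norm_pow, norm_mul, hw, one_mul, norm_real, Real.norm_of_nonneg hu]

theorem hasDerivAt_rayExp_smul (d : ℕ) (a : Fin (d - 1) → ℂ) (k : ℕ) (u : ℝ) (τ : ℂ) :
    HasDerivAt (fun τ : ℂ => rayExp d (τ • a) k u)
      (rayExp d (τ • a) k u * ∑ i : Fin (d - 1), a i * (omegaPow d k * u) ^ ((i : ℕ) + 1)) τ := by
  simp only [rayExp, eval_P₀_smul]
  refine HasDerivAt.cexp ?_
  have h := ((hasDerivAt_id τ).mul_const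
    (∑ i : Fin (d - 1), a i * (omegaPow d k * u) ^ ((i : ℕ) + 1))).const_add
      (-1 / (d : ℂ) * (omegaPow d k * u) ^ d)
  rwa [one_mul] at h

/-- Differentiation under the integral sign, with the bound of `norm_rayExp_smul_le` on the unit
ball around `τ`. -/
theorem hasDerivAt_mellin_rayExp_smul (d : ℕ) (hd : 1 ≤ d) (a : Fin (d - 1) → ℂ) (k : ℕ) {s : ℂ}
    (hs : 0 < s.re) (τ : ℂ) :
    HasDerivAt (fun τ : ℂ => mellin (rayExp d (τ • a) k) s)
      (∑ i : Fin (d - 1), a i * omegaPow d k ^ ((i : ℕ) + 1) *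
        mellin (rayExp d (τ • a) k) (s + ((i : ℕ) : ℂ) + 1)) τ := by
  set w := omegaPow d k with hw
  have hw1 : ‖w‖ = 1 := norm_omegaPow_natCast d k
  have hsi : ∀ i : Fin (d - 1), 0 < (s + ((i : ℕ) : ℂ) + 1).re := fun i => by
    simp only [add_re, natCast_re, one_re]; positivity
  set b : Fin (d - 1) → ℂ := fun i => (((‖τ‖ + 1) * ‖a i‖ : ℝ) : ℂ)
  have hconv : ∀ i : Fin (d - 1),
      MellinConvergent (rayExp d (τ • a) k) (s + ((i : ℕ) : ℂ) + 1) :=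
    fun i => rayExp_mellinConvergent d hd _ k (hsi i)
  have hpow : ∀ (i : Fin (d - 1)) {u : ℝ}, 0 < u →
      (u : ℂ) ^ (s + ((i : ℕ) : ℂ) + 1 - 1) = (u : ℂ) ^ (s - 1) * (u : ℂ) ^ ((i : ℕ) + 1) := by
    intro i u hu
    rw [← cpow_natCast, ← cpow_add _ _ (by exact_mod_cast hu.ne')]
    push_cast
    ring_nf
  have key := (hasDerivAt_integral_of_dominated_loc_of_deriv_le (𝕜 := ℂ) (x₀ := τ)
    (μ := volume.restrict (Ioi (0 : ℝ)))
    (F := fun τ u => (u : ℂ) ^ (s - 1) • rayExp d (τ • a) k u)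
    (F' := fun τ u => ∑ i : Fin (d - 1), a i * w ^ ((i : ℕ) + 1) *
      ((u : ℂ) ^ (s + ((i : ℕ) : ℂ) + 1 - 1) • rayExp d (τ • a) k u))
    (bound := fun u => ∑ i : Fin (d - 1), ‖a i‖ *
      ‖(u : ℂ) ^ (s + ((i : ℕ) : ℂ) + 1 - 1) • rayExp d b 0 u‖)
    (Metric.ball_mem_nhds τ one_pos)
    (Eventually.of_forall fun τ' =>
      (rayExp_mellinConvergent d hd (τ' • a) k hs).aestronglyMeasurable)
    (rayExp_mellinConvergent d hd (τ • a) k hs)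
    (integrable_finsetSum _ fun i _ => (hconv i).const_mul _).aestronglyMeasurable
    ?_ (integrable_finsetSum _ fun i _ =>
      (rayExp_mellinConvergent d hd b 0 (hsi i)).norm.const_mul _) ?_).2
  · refine key.congr_deriv ?_
    rw [integral_finsetSum _ fun i _ => (hconv i).const_mul _]
    exact Finset.sum_congr rfl fun i _ => integral_const_mul _ _
  · filter_upwards [ae_restrict_mem measurableSet_Ioi] with u hu τ' hτ'
    have hτ1 : ‖τ'‖ ≤ ‖τ‖ + 1 := by
      have h1 : ‖τ' - τ‖ < 1 := by rwa [← dist_eq_norm]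
      have h2 := norm_add_le τ (τ' - τ)
      rw [add_sub_cancel] at h2
      linarith
    refine (norm_sum_le _ _).trans (Finset.sum_le_sum fun i _ => ?_)
    rw [norm_mul, norm_mul, norm_pow, hw1, one_pow, mul_one, norm_smul, norm_smul]
    gcongr
    exact norm_rayExp_smul_le d hd a k hτ1 (le_of_lt hu)
  · filter_upwards [ae_restrict_mem measurableSet_Ioi] with u hu τ' _
    refine ((hasDerivAt_rayExp_smul d a k u τ').const_smul ((u : ℂ) ^ (s - 1))).congr_deriv ?_
    rw [Finset.mul_sum, Finset.smul_sum]
    refine Finset.sum_congr rfl fun i _ => ?_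
    rw [hpow i hu, mul_pow, smul_eq_mul, smul_eq_mul]
    ring

theorem hasDerivAt_rayIntegral_smul (d : ℕ) (hd : 1 ≤ d) (a : Fin (d - 1) → ℂ) (k : ℕ) {s : ℂ}
    (hs : 0 < s.re) (τ : ℂ) :
    HasDerivAt (fun τ : ℂ => rayIntegral d (τ • a) k s)
      (∑ i : Fin (d - 1), a i * rayIntegral d (τ • a) k (s + ((i : ℕ) : ℂ) + 1)) τ := by
  simp only [rayIntegral_eq]
  refine ((hasDerivAt_mellin_rayExp_smul d hd a k hs τ).const_mul _).congr_deriv ?_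
  rw [Finset.mul_sum]
  refine Finset.sum_congr rfl fun i _ => ?_
  have h : omegaPow d (k * (s + ((i : ℕ) : ℂ) + 1)) =
      omegaPow d (k * s) * omegaPow d k ^ ((i : ℕ) + 1) := by
    rw [← omegaPow_mul_nat, ← omegaPow_add]
    push_cast
    ring_nf
  rw [h]
  ring

/-- Differentiating in the direction of the parameters raises the argument: formally
`∂Ω_k(s) / ∂a_l = Ω_k(s + l)`. -/
theorem hasDerivAt_Omega_smul (d : ℕ) (hd : 1 ≤ d) (a : Fin (d - 1) → ℂ) (k : ℕ) (τ : ℂ) {s : ℂ}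
    (hs : ∀ m : ℕ, s ≠ -(m : ℂ)) :
    HasDerivAt (fun τ : ℂ => Omega d (τ • a) k s)
      (∑ i : Fin (d - 1), a i * Omega d (τ • a) k (s + ((i : ℕ) : ℂ) + 1)) τ := by
  obtain ⟨n, hn⟩ := exists_nat_gt (-s.re)
  induction n generalizing s with
  | zero =>
    have hs0 : 0 < s.re := by simpa using hn
    have h1 : (fun τ : ℂ => Omega d (τ • a) k s) = fun τ => rayIntegral d (τ • a) k s :=
      funext fun τ => Omega_eq_rayIntegral d _ k hs0
    rw [h1]
    refine (hasDerivAt_rayIntegral_smul d hd a k hs0 τ).congr_deriv ?_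
    refine Finset.sum_congr rfl fun i _ => ?_
    rw [Omega_eq_rayIntegral]
    simp only [add_re, natCast_re, one_re]
    positivity
  | succ n ih =>
    have hs0 : s ≠ 0 := by simpa using hs 0
    have hne : ∀ l m : ℕ, s + (l : ℂ) ≠ -(m : ℂ) := fun l m h =>
      hs (m + l) (by push_cast; linear_combination h)
    have hsucc : ∀ l : ℕ, 1 ≤ l → HasDerivAt (fun τ : ℂ => Omega d (τ • a) k (s + (l : ℂ)))
        (∑ i : Fin (d - 1), a i * Omega d (τ • a) k (s + (l : ℂ) + ((i : ℕ) : ℂ) + 1)) τ := by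
      intro l hl
      refine ih (hne l) ?_
      have : (1 : ℝ) ≤ l := by exact_mod_cast hl
      simp only [add_re, natCast_re]
      push_cast at hn
      linarith
    have hcast : ∀ i : ℕ, s + (i : ℂ) + 1 = s + ((i + 1 : ℕ) : ℂ) := fun i => by push_cast; ring
    have hfun : (fun τ : ℂ => Omega d (τ • a) k s) = fun τ : ℂ =>
        (Omega d (τ • a) k (s + d) - ∑ i : Fin (d - 1),
          τ * ((((i : ℕ) : ℂ) + 1) * a i) * Omega d (τ • a) k (s + ((i + 1 : ℕ) : ℂ))) / s := by
      funext τ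
      rw [eq_div_iff hs0, mul_comm, Omega_functional d hd _ k hs0]
      congr 1
      refine Finset.sum_congr rfl fun i _ => ?_
      rw [hcast, Pi.smul_apply, smul_eq_mul]
      ring
    rw [hfun]
    have hD := ((hsucc d hd).sub (HasDerivAt.fun_sum (u := Finset.univ)
      fun (i : Fin (d - 1)) _ =>
        ((hasDerivAt_id τ).mul_const ((((i : ℕ) : ℂ) + 1) * a i)).mul
          (hsucc ((i : ℕ) + 1) (by omega)))).div_const s
    refine hD.congr_deriv ?_
    rw [div_eq_iff hs0, Finset.sum_add_distrib]
    simp only [id_eq, one_mul]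
    -- The functional equation at `s + j + 1`, weighted with `a j`, where the factor
    -- `s + (j + 1)` splits into `s` and the derivative of the coefficient `(j + 1) τ a j`.
    have hfe : ∀ j : Fin (d - 1), a j * (s + ((j + 1 : ℕ) : ℂ)) *
        Omega d (τ • a) k (s + ((j + 1 : ℕ) : ℂ)) =
        a j * Omega d (τ • a) k (s + (d : ℂ) + ((j : ℕ) : ℂ) + 1) -
          ∑ i : Fin (d - 1), τ * ((((i : ℕ) : ℂ) + 1) * a i) *
            (a j * Omega d (τ • a) k (s + ((i + 1 : ℕ) : ℂ) + ((j : ℕ) : ℂ) + 1)) := by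
      intro j
      have hj : s + ((j + 1 : ℕ) : ℂ) ≠ 0 := by simpa using hne (j + 1) 0
      rw [mul_assoc, Omega_functional d hd _ k hj, mul_sub, Finset.mul_sum]
      congr 1
      · congr 2; push_cast; ring
      · refine Finset.sum_congr rfl fun i _ => ?_
        rw [show s + ((j + 1 : ℕ) : ℂ) + ((i : ℕ) : ℂ) + 1 =
          s + ((i + 1 : ℕ) : ℂ) + ((j : ℕ) : ℂ) + 1 by push_cast; ring, Pi.smul_apply, smul_eq_mul]
        ring
    have hsum := Finset.sum_congr (rfl : (Finset.univ : Finset (Fin (d - 1))) = _)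
      fun j _ => hfe j
    rw [Finset.sum_sub_distrib, Finset.sum_comm] at hsum
    simp only [hcast] at hsum ⊢
    simp only [Finset.mul_sum]
    rw [Finset.sum_mul]
    have hsplit : ∑ j : Fin (d - 1), a j * (s + ((j + 1 : ℕ) : ℂ)) *
        Omega d (τ • a) k (s + ((j + 1 : ℕ) : ℂ)) =
        ∑ j : Fin (d - 1), a j * Omega d (τ • a) k (s + ((j + 1 : ℕ) : ℂ)) * s +
        ∑ j : Fin (d - 1), (((j : ℕ) : ℂ) + 1) * a j *
          Omega d (τ • a) k (s + ((j + 1 : ℕ) : ℂ)) := by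
      rw [← Finset.sum_add_distrib]
      refine Finset.sum_congr rfl fun j _ => ?_
      push_cast
      ring
    rw [hsplit] at hsum
    linear_combination -hsum

/-! ### The differential equation of the determinant along rays -/


/-- Jacobi's formula for a matrix solution of the linear equation `W' = W * M`. -/
theorem hasDerivAt_det_of_hasDerivAt_mul {n : Type*} [Fintype n] [DecidableEq n]
    {W : ℂ → Matrix n n ℂ} {M : Matrix n n ℂ} {τ : ℂ}
    (hW : ∀ i j, HasDerivAt (fun t => W t i j) ((W τ * M) i j) τ) :
    HasDerivAt (fun t => (W t).det) (M.trace * (W τ).det) τ := by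
  -- Column `j` of `W * M` is a combination of the columns of `W`, of which only the `j`-th, with
  -- coefficient `M j j`, survives in the determinant.
  have hcol : ∀ j, M j j * (W τ).det = ∑ σ : Equiv.Perm n, (Equiv.Perm.sign σ : ℤ) •
      ((∏ i ∈ Finset.univ.erase j, W τ (σ i) i) * (W τ * M) (σ j) j) := by
    intro j
    have h := Matrix.det_updateCol_sum (W τ) j (fun i => M i j)
    rw [smul_eq_mul] at h
    rw [← h, Matrix.det_apply]
    refine Finset.sum_congr rfl fun σ _ => ?_
    rw [← Finset.prod_erase_mul _ _ (Finset.mem_univ j), Matrix.updateCol_self]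
    congr 2
    · exact Finset.prod_congr rfl fun i hi => Matrix.updateCol_ne (Finset.ne_of_mem_erase hi)
    · rw [Matrix.mul_apply]
      exact Finset.sum_congr rfl fun i _ => mul_comm _ _
  simp only [Matrix.det_apply (W _)]
  refine (HasDerivAt.fun_sum fun σ _ =>
    (HasDerivAt.fun_finsetProd (u := Finset.univ) fun i _ => hW (σ i) i).const_smul
      (Equiv.Perm.sign σ : ℤ)).congr_deriv ?_
  rw [← Matrix.det_apply, Matrix.trace, Finset.sum_mul]
  simp only [Matrix.diag_apply, hcol, Finset.smul_sum, smul_eq_mul]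
  exact Finset.sum_comm

/-- Modulo the functional equation every `Ω_k(s + n + 1)` is a combination of
`Ω_k(s + 1), …, Ω_k(s + d)`, with universal coefficients polynomial in `s` and the parameters. -/
theorem exists_reduction_coeff (d : ℕ) (hd : 1 ≤ d) (n : ℕ) :
    ∃ p : Fin d → MvPolynomial (Option (Fin (d - 1))) ℚ,
      ∀ (a : Fin (d - 1) → ℂ) (k : ℕ) (s : ℂ), (∀ m : ℕ, s ≠ -((m : ℂ) + 1)) →
        Omega d a k (s + (n : ℂ) + 1) = ∑ l : Fin d,
          MvPolynomial.aeval (fun i : Option (Fin (d - 1)) => i.elim s a) (p l) *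
            Omega d a k (s + ((l : ℕ) : ℂ) + 1) := by
  induction n using Nat.strong_induction_on with
  | _ n ih =>
    rcases lt_or_ge n d with hn | hn
    · refine ⟨fun l => if l = ⟨n, hn⟩ then 1 else 0, fun a k s _ => ?_⟩
      rw [Finset.sum_eq_single ⟨n, hn⟩]
      · simp
      · intro l _ hl; simp [hl]
      · simp
    · obtain ⟨m, rfl⟩ : ∃ m, n = m + d := ⟨n - d, by omega⟩
      choose p hp using ih
      refine ⟨fun l => (MvPolynomial.X none + (m : MvPolynomial (Option (Fin (d - 1))) ℚ) + 1) *
          p m (by omega) l + ∑ i : Fin (d - 1),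
            (((i : ℕ) : MvPolynomial (Option (Fin (d - 1))) ℚ) + 1) * MvPolynomial.X (some i) *
              p (m + 1 + i) (by have := i.2; omega) l, fun a k s hs => ?_⟩
      have hs0 : s + (m : ℂ) + 1 ≠ 0 := fun h => hs m (by linear_combination h)
      have hf := Omega_functional d hd a k hs0
      rw [hp m (by omega) a k s hs] at hf
      have hi : ∀ i : Fin (d - 1), Omega d a k (s + (m : ℂ) + 1 + ((i : ℕ) : ℂ) + 1) =
          Omega d a k (s + ((m + 1 + i : ℕ) : ℂ) + 1) := fun i => by
        congr 1; push_cast; ring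
      simp only [hi, fun i : Fin (d - 1) => hp (m + 1 + i) (by have := i.2; omega) a k s hs] at hf
      rw [show s + ((m + d : ℕ) : ℂ) + 1 = s + (m : ℂ) + 1 + d by push_cast; ring,
        eq_add_of_sub_eq hf.symm]
      simp only [map_add, map_mul, map_sum, map_natCast, map_one, MvPolynomial.aeval_X,
        Option.elim_none, Option.elim_some, Finset.mul_sum]
      rw [Finset.sum_comm, ← Finset.sum_add_distrib]
      refine Finset.sum_congr rfl fun l _ => ?_
      conv_rhs => rw [add_mul, Finset.sum_mul]
      congr 1
      · ring
      · exact Finset.sum_congr rfl fun i _ => by ring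

/-- Integration of a polynomial along the segment from `0` to `a` in parameter space: along it
`p` has a primitive whose value at the end point is again a polynomial in `s` and `a` over `ℚ`. -/
theorem exists_primitive_along_ray {σ : Type*} (p r : MvPolynomial (Option σ) ℚ) :
    ∃ P : MvPolynomial (Option σ) ℚ, ∀ (s : ℂ) (a : σ → ℂ), ∃ g : ℂ → ℂ,
      g 0 = 0 ∧ g 1 = MvPolynomial.aeval (fun i : Option σ => i.elim s a) P ∧
      ∀ τ, HasDerivAt g (MvPolynomial.aeval (fun i : Option σ => i.elim s a) r *
        MvPolynomial.aeval (fun i : Option σ => i.elim s (τ • a)) p) τ := by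
  -- `q` is `p` with `a` replaced by `X * a`, as a polynomial in the scale `X`.
  let q : Polynomial (MvPolynomial (Option σ) ℚ) :=
    MvPolynomial.aeval (fun i : Option σ => i.elim (Polynomial.C (MvPolynomial.X none))
      fun j => Polynomial.X * Polynomial.C (MvPolynomial.X (some j))) p
  have hq : ∀ (s : ℂ) (a : σ → ℂ) (τ : ℂ),
      MvPolynomial.aeval (fun i : Option σ => i.elim s (τ • a)) p =
        q.eval₂ (MvPolynomial.aeval (R := ℚ) fun i : Option σ => i.elim s a).toRingHom τ := by
    intro s a τ
    induction p using MvPolynomial.induction_on with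
    | C c => simp [q, Polynomial.eval₂_C, IsScalarTower.algebraMap_apply ℚ
        (MvPolynomial (Option σ) ℚ) (Polynomial (MvPolynomial (Option σ) ℚ))]
    | add p₁ p₂ h₁ h₂ => simp only [q, map_add, Polynomial.eval₂_add] at *; rw [h₁, h₂]
    | mul_X p₁ i h =>
      simp only [q, map_mul, Polynomial.eval₂_mul, MvPolynomial.aeval_X] at *
      rw [h]
      cases i with
      | none => simp
      | some j => simpa using Or.inl (mul_comm _ _)
  refine ⟨r * ∑ n ∈ q.support, MvPolynomial.C (1 / ((n : ℚ) + 1)) * q.coeff n, fun s a => ?_⟩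
  let φ := MvPolynomial.aeval (R := ℚ) fun i : Option σ => i.elim s a
  refine ⟨fun τ => φ r * ∑ n ∈ q.support, φ (q.coeff n) * (τ ^ (n + 1) / ((n : ℂ) + 1)),
    by simp, ?_, fun τ => ?_⟩
  · simp only [map_mul, map_sum, MvPolynomial.aeval_C, φ, one_pow]
    congr 1
    refine Finset.sum_congr rfl fun n _ => ?_
    simp [mul_comm]
  · rw [hq, Polynomial.eval₂_eq_sum, Polynomial.sum]
    refine HasDerivAt.const_mul _ (HasDerivAt.fun_sum fun n _ => HasDerivAt.const_mul _ ?_)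
    have hn : (n : ℂ) + 1 ≠ 0 := by exact_mod_cast n.succ_ne_zero
    have := (hasDerivAt_pow (n + 1) τ).div_const ((n : ℂ) + 1)
    refine this.congr_deriv ?_
    push_cast
    field_simp

/-- Along each ray `τ ↦ τ a` in parameter space the determinant satisfies `Δ' = T Δ`, with `T` the
trace of a matrix which is polynomial in `s` and `τ a`; so `Δ` changes by the exponential of a
polynomial. -/
theorem exists_Delta_eq_mul_exp (d : ℕ) (hd : 1 ≤ d) :
    ∃ Pi_d : MvPolynomial (Option (Fin (d - 1))) ℚ,
      ∀ (a : Fin (d - 1) → ℂ) (s : ℂ), (∀ n : ℕ, s ≠ -((n : ℂ) + 1)) →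
        Delta d a s = Delta d 0 s *
          Complex.exp (MvPolynomial.aeval (fun i : Option (Fin (d - 1)) => i.elim s a) Pi_d) := by
  choose p hp using exists_reduction_coeff d hd
  choose P hP using fun (i : Fin (d - 1)) =>
    exists_primitive_along_ray (∑ l : Fin d, p (l + i + 1) l) (MvPolynomial.X (some i))
  refine ⟨∑ i, P i, fun a s hs => ?_⟩
  choose g hg0 hg1 hg using fun i => hP i s a
  let M : ℂ → Matrix (Fin d) (Fin d) ℂ := fun τ => Matrix.of fun m l =>
    ∑ i : Fin (d - 1), a i *
      MvPolynomial.aeval (fun i : Option (Fin (d - 1)) => i.elim s (τ • a)) (p (l + i + 1) m)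
  have hW : ∀ τ, HasDerivAt (fun τ : ℂ => Delta d (τ • a) s)
      ((M τ).trace * Delta d (τ • a) s) τ := by
    intro τ
    refine hasDerivAt_det_of_hasDerivAt_mul fun k l => ?_
    have hsl : ∀ m : ℕ, s + ((l : ℕ) : ℂ) + 1 ≠ -(m : ℂ) := fun m h =>
      hs (m + l) (by push_cast; linear_combination h)
    refine (hasDerivAt_Omega_smul d hd a k τ hsl).congr_deriv ?_
    simp only [Matrix.mul_apply, omegaMatrix, Matrix.of_apply, M, Finset.mul_sum]
    rw [Finset.sum_comm]
    refine Finset.sum_congr rfl fun i _ => ?_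
    rw [show s + ((l : ℕ) : ℂ) + 1 + ((i : ℕ) : ℂ) + 1 = s + ((l + i + 1 : ℕ) : ℂ) + 1 by
      push_cast; ring, hp (l + i + 1) (τ • a) k s hs, Finset.mul_sum]
    exact Finset.sum_congr rfl fun m _ => by ring
  have hG : ∀ τ, HasDerivAt (fun τ => ∑ i, g i τ) (M τ).trace τ := by
    intro τ
    refine (HasDerivAt.fun_sum fun i _ => hg i τ).congr_deriv ?_
    simp only [Matrix.trace, Matrix.diag_apply, M, Matrix.of_apply, map_sum, MvPolynomial.aeval_X,
      Option.elim_some, Finset.mul_sum]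
    exact Finset.sum_comm
  -- So `Δ exp (-∑ g i)` is constant along the ray.
  have hconst : ∀ τ, HasDerivAt
      (fun τ : ℂ => Delta d (τ • a) s * Complex.exp (-∑ i, g i τ)) 0 τ := fun τ =>
    ((hW τ).mul (hG τ).neg.cexp).congr_deriv (by ring)
  have h01 := is_const_of_deriv_eq_zero (fun τ => (hconst τ).differentiableAt)
    (fun τ => (hconst τ).deriv) 1 0
  simp only [one_smul, zero_smul, hg0, hg1, Finset.sum_const_zero, neg_zero, Complex.exp_zero,
    mul_one] at h01
  rw [← h01, map_sum, mul_assoc, ← Complex.exp_add, neg_add_cancel, Complex.exp_zero, mul_one]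

/-! ### The Gauss multiplication formula -/


/-- The denominators of Euler's products for the points `(z + l) / (m + 1)`, `0 ≤ l ≤ m`, interleave
to that for `z`. -/
theorem prod_prod_div_add (m n : ℕ) (z : ℂ) :
    ∏ l ∈ Finset.range (m + 1), ∏ j ∈ Finset.range n, ((z + l) / ((m : ℂ) + 1) + j) =
      (∏ k ∈ Finset.range ((m + 1) * n), (z + k)) / ((m : ℂ) + 1) ^ ((m + 1) * n) := by
  have hm : (m : ℂ) + 1 ≠ 0 := by exact_mod_cast m.succ_ne_zero
  induction n with
  | zero => simp
  | succ n ih =>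
    simp only [Finset.prod_range_succ _ n, Finset.prod_mul_distrib]
    rw [ih, mul_add, mul_one, Finset.prod_range_add _ ((m + 1) * n), pow_add, mul_div_mul_comm]
    congr 1
    rw [eq_div_iff (pow_ne_zero _ hm)]
    conv_lhs => rw [← Finset.card_range (m + 1), ← Finset.prod_const]
    rw [Finset.card_range, ← Finset.prod_mul_distrib]
    refine Finset.prod_congr rfl fun l _ => ?_
    push_cast
    field_simp
    ring

theorem sum_range_add_div (m : ℕ) (z : ℂ) :
    ∑ l ∈ Finset.range (m + 1), (z + l) / ((m : ℂ) + 1) = z + m / 2 := by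
  have hm : (m : ℂ) + 1 ≠ 0 := by exact_mod_cast m.succ_ne_zero
  have h : ∀ k : ℕ, ∑ l ∈ Finset.range (k + 1), (z + l) = (k + 1) * (z + k / 2) := by
    intro k
    induction k with
    | zero => simp
    | succ k ih => rw [Finset.sum_range_succ, ih]; push_cast; ring
  rw [← Finset.sum_div, h]
  field_simp

theorem prod_cpow_eq_cpow_sum {ι : Type*} (t : Finset ι) (f : ι → ℂ) {x : ℂ} (hx : x ≠ 0) :
    ∏ i ∈ t, x ^ f i = x ^ ∑ i ∈ t, f i := by
  simp only [cpow_def_of_ne_zero hx, Finset.mul_sum, Complex.exp_sum]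

theorem natCast_cpow_half_mul (n m : ℕ) :
    (n : ℂ) ^ ((m : ℂ) / 2) = ((√(n : ℝ) ^ m : ℝ) : ℂ) := by
  rw [Real.sqrt_eq_rpow, ← Real.rpow_natCast, ← Real.rpow_mul n.cast_nonneg,
    ofReal_cpow n.cast_nonneg]
  push_cast
  ring_nf

/-- The part independent of `z` of the quotient of the product over `l` of the Euler approximations
to `Γ((z + l) / (m + 1))` by the one to `Γ(z)`. -/
noncomputable def multiplicationSeq (m n : ℕ) : ℝ :=
  √(n : ℝ) ^ m * (n.factorial : ℝ) ^ (m + 1) * ((m : ℝ) + 1) ^ ((m + 1) * (n + 1)) /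
    (((m + 1) * n + m).factorial : ℝ)

theorem prod_GammaSeq_eq (m : ℕ) (z : ℂ) {n : ℕ} (hn : n ≠ 0) :
    ∏ l ∈ Finset.range (m + 1), GammaSeq ((z + l) / ((m : ℂ) + 1)) n =
      (multiplicationSeq m n : ℂ) * (((n : ℝ) / (((m + 1) * n + m : ℕ) : ℝ) : ℝ) : ℂ) ^ z *
        GammaSeq z ((m + 1) * n + m) := by
  have hm : (m : ℂ) + 1 ≠ 0 := by exact_mod_cast m.succ_ne_zero
  have hn0 : (n : ℂ) ≠ 0 := by exact_mod_cast hn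
  set N := (m + 1) * n + m with hN
  have hN0 : (N : ℝ) ≠ 0 := by
    have : 0 < N := by positivity
    exact_mod_cast this.ne'
  have hN1 : (m + 1) * (n + 1) = N + 1 := by rw [hN]; ring
  simp only [GammaSeq]
  rw [Finset.prod_div_distrib, prod_prod_div_add, Finset.prod_mul_distrib, Finset.prod_const,
    Finset.card_range, prod_cpow_eq_cpow_sum _ _ hn0, sum_range_add_div, cpow_add _ _ hn0,
    natCast_cpow_half_mul]
  have hsplit : (n : ℂ) ^ z = (((n : ℝ) / (N : ℝ) : ℝ) : ℂ) ^ z * (N : ℂ) ^ z := by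
    have := mul_cpow_ofReal_nonneg (a := (n : ℝ) / N) (b := N) (by positivity) (by positivity) z
    rw [← ofReal_mul, div_mul_cancel₀ _ hN0] at this
    simpa using this
  have hf : (N.factorial : ℂ) ≠ 0 := by exact_mod_cast N.factorial_ne_zero
  rw [hsplit, multiplicationSeq, ← hN, hN1]
  push_cast
  have hfac : ((N.factorial : ℂ))⁻¹ * N.factorial = 1 := inv_mul_cancel₀ hf
  simp only [div_eq_mul_inv, mul_inv, inv_inv]
  linear_combination (-((((√(n : ℝ) : ℝ) : ℂ)) ^ m * (n.factorial : ℂ) ^ (m + 1) *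
    ((m : ℂ) + 1) ^ (N + 1) * ((n : ℂ) * (N : ℂ)⁻¹) ^ z * (N : ℂ) ^ z *
      (∏ k ∈ Finset.range (N + 1), (z + k))⁻¹)) * hfac

/-- Up to a product tending to `1`, which accounts for the quotient of `((m + 1) * n + m)!` by
`((m + 1) * n)!`, the correction factor is a quotient of Stirling approximations. -/
theorem multiplicationSeq_eq (m : ℕ) {n : ℕ} (hn : n ≠ 0) :
    multiplicationSeq m n =
      Stirling.stirlingSeq n ^ (m + 1) / Stirling.stirlingSeq ((m + 1) * n) *
        (√2 ^ m * √((m : ℝ) + 1)) *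
        ∏ j ∈ Finset.range m,
          ((((m + 1) * n : ℕ) : ℝ) / ((((m + 1) * n : ℕ) : ℝ) + ((j : ℝ) + 1))) := by
  have hn0 : (0 : ℝ) < n := by positivity
  have hm0 : (0 : ℝ) < (m : ℝ) + 1 := by positivity
  have hfac : ((((m + 1) * n + m).factorial : ℕ) : ℝ) = ((m + 1) * n).factorial *
      ∏ j ∈ Finset.range m, ((((m + 1) * n : ℕ) : ℝ) + ((j : ℝ) + 1)) := by
    rw [← Nat.factorial_mul_ascFactorial, Nat.ascFactorial_eq_prod_range]
    push_cast
    congr 1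
    exact Finset.prod_congr rfl fun j _ => by ring
  have hP : ∏ j ∈ Finset.range m, ((((m + 1) * n : ℕ) : ℝ) + ((j : ℝ) + 1)) ≠ 0 :=
    Finset.prod_ne_zero_iff.2 fun j _ => by positivity
  have hsq : √(n : ℝ) ^ m * √(n : ℝ) ^ m = (n : ℝ) ^ m := by
    rw [← mul_pow, Real.mul_self_sqrt hn0.le]
  have hsqm : √((m : ℝ) + 1) * √((m : ℝ) + 1) = (m : ℝ) + 1 := Real.mul_self_sqrt hm0.le
  have h2 : √(2 * (((m + 1) * n : ℕ) : ℝ)) = √2 * √((m : ℝ) + 1) * √(n : ℝ) := by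
    push_cast
    rw [Real.sqrt_mul zero_le_two, Real.sqrt_mul hm0.le, mul_assoc]
  have hf : (((m + 1) * n).factorial : ℝ) ≠ 0 := by exact_mod_cast Nat.factorial_ne_zero _
  rw [multiplicationSeq, hfac, Finset.prod_div_distrib, Finset.prod_const, Finset.card_range,
    Stirling.stirlingSeq, Stirling.stirlingSeq, h2, Real.sqrt_mul zero_le_two]
  have he := Real.exp_pos 1
  have hs2 : (0 : ℝ) < √2 := by positivity
  have hsn : (0 : ℝ) < √(n : ℝ) := by positivity
  have hsm : (0 : ℝ) < √((m : ℝ) + 1) := by positivity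
  generalize ∏ j ∈ Finset.range m, ((((m + 1) * n : ℕ) : ℝ) + ((j : ℝ) + 1)) = Q at hP
  generalize (((m + 1) * n).factorial : ℝ) = F at hf
  generalize √(2 : ℝ) = r at hs2
  have hr := hs2.ne'
  have hsn' := hsn.ne'
  have hsm' := hsm.ne'
  push_cast
  have h3 : (((n : ℝ) / Real.exp 1) ^ n) ^ (m + 1) =
      (n : ℝ) ^ ((m + 1) * n) / Real.exp 1 ^ ((m + 1) * n) := by
    rw [← pow_mul, mul_comm n, div_pow]
  have h4 : (((m : ℝ) + 1) * n / Real.exp 1) ^ ((m + 1) * n) =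
      ((m : ℝ) + 1) ^ ((m + 1) * n) * (n : ℝ) ^ ((m + 1) * n) / Real.exp 1 ^ ((m + 1) * n) := by
    rw [div_pow, mul_pow]
  have h5 : ((m : ℝ) + 1) ^ ((m + 1) * (n + 1)) =
      ((m : ℝ) + 1) ^ ((m + 1) * n) * (((m : ℝ) + 1) ^ m * ((m : ℝ) + 1)) := by
    rw [mul_add, mul_one, pow_add _ ((m + 1) * n), pow_succ _ m]
  rw [div_pow, mul_pow (r * √(n : ℝ)), mul_pow r, h3, h4, h5, mul_pow ((m : ℝ) + 1) _ m,
    pow_succ r, pow_succ (√(n : ℝ)), ← hsq]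
  field_simp
  rw [sq, hsqm]

theorem tendsto_natCast_div_natCast_add (m : ℕ) (c : ℝ) :
    Tendsto (fun n : ℕ => (((m + 1) * n : ℕ) : ℝ) / ((((m + 1) * n : ℕ) : ℝ) + c)) atTop (𝓝 1) :=
  (tendsto_natCast_div_add_atTop c).comp
    (tendsto_id.const_mul_atTop' m.succ_pos)

theorem tendsto_multiplicationSeq (m : ℕ) :
    Tendsto (multiplicationSeq m) atTop (𝓝 (√(2 * Real.pi) ^ m * √((m : ℝ) + 1))) := by
  have hpi : √Real.pi ≠ 0 := by positivity
  have hmul : Tendsto (fun n : ℕ => (m + 1) * n) atTop atTop :=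
    tendsto_id.const_mul_atTop' m.succ_pos
  have h := (((Stirling.tendsto_stirlingSeq_sqrt_pi.pow (m + 1)).div
    (Stirling.tendsto_stirlingSeq_sqrt_pi.comp hmul) hpi).mul_const
      (√2 ^ m * √((m : ℝ) + 1))).mul (tendsto_finsetProd (Finset.range m)
        fun j _ => tendsto_natCast_div_natCast_add m ((j : ℝ) + 1))
  have hval : √Real.pi ^ (m + 1) / √Real.pi * (√2 ^ m * √((m : ℝ) + 1)) *
      ∏ j ∈ Finset.range m, (1 : ℝ) = √(2 * Real.pi) ^ m * √((m : ℝ) + 1) := by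
    rw [Finset.prod_const_one, mul_one, pow_succ, mul_div_cancel_right₀ _ hpi,
      Real.sqrt_mul zero_le_two, mul_pow]
    ring
  rw [hval] at h
  refine h.congr' ?_
  filter_upwards [eventually_ne_atTop 0] with n hn
  exact (multiplicationSeq_eq m hn).symm

/-- The Gauss multiplication formula for the Gamma function (at a pole both sides vanish, by the
convention for the value of `Gamma` there). -/
theorem prod_Gamma_add_div (m : ℕ) (z : ℂ) :
    ∏ l ∈ Finset.range (m + 1), Gamma ((z + l) / ((m : ℂ) + 1)) =
      ((√(2 * Real.pi) ^ m * √((m : ℝ) + 1) : ℝ) : ℂ) * (((1 / ((m : ℝ) + 1) : ℝ)) : ℂ) ^ z *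
        Gamma z := by
  have hN : Tendsto (fun n : ℕ => (m + 1) * n + m) atTop atTop :=
    tendsto_atTop_mono (fun n => Nat.le_add_right _ _) (tendsto_id.const_mul_atTop' m.succ_pos)
  have hm : (0 : ℝ) < (m : ℝ) + 1 := by positivity
  have hratio : Tendsto (fun n : ℕ => (n : ℝ) / (((m + 1) * n + m : ℕ) : ℝ)) atTop
      (𝓝 (1 / ((m : ℝ) + 1))) := by
    refine ((tendsto_natCast_div_natCast_add m m).div_const ((m : ℝ) + 1)).congr fun n => ?_
    push_cast
    rw [div_div, mul_comm _ ((m : ℝ) + 1), mul_div_mul_left _ _ hm.ne']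
  have hpow : Tendsto (fun n : ℕ => (((n : ℝ) / (((m + 1) * n + m : ℕ) : ℝ) : ℝ) : ℂ) ^ z) atTop
      (𝓝 ((((1 / ((m : ℝ) + 1) : ℝ)) : ℂ) ^ z)) := by
    refine Tendsto.cpow ((continuous_ofReal.tendsto _).comp hratio) tendsto_const_nhds ?_
    exact ofReal_mem_slitPlane.2 (by positivity)
  refine tendsto_nhds_unique (tendsto_finsetProd (Finset.range (m + 1)) fun l _ =>
    GammaSeq_tendsto_Gamma ((z + l) / ((m : ℂ) + 1))) ?_
  refine ((((continuous_ofReal.tendsto _).comp (tendsto_multiplicationSeq m)).mul hpow).mul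
    ((GammaSeq_tendsto_Gamma z).comp hN)).congr' ?_
  filter_upwards [eventually_ne_atTop 0] with n hn
  exact (prod_GammaSeq_eq m z hn).symm

/-! ### The Vandermonde determinant of the roots of unity -/


theorem omegaPow_one_isPrimitiveRoot (d : ℕ) (hd : 1 ≤ d) : IsPrimitiveRoot (omegaPow d 1) d := by
  have := Complex.isPrimitiveRoot_exp d (by omega)
  rwa [omegaPow, mul_one]

theorem omegaPow_natCast (d k : ℕ) : omegaPow d k = omegaPow d 1 ^ k := by
  rw [← omegaPow_mul_nat, one_mul]

theorem conj_omegaPow_natCast (d k : ℕ) :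
    (starRingEnd ℂ) (omegaPow d k) = (omegaPow d k)⁻¹ := by
  rw [omegaPow, ← exp_conj, ← exp_neg]
  simp [neg_mul, mul_neg, neg_div, map_ofNat]

/-- The rows of the Vandermonde matrix of the `d`-th roots of unity are orthogonal, of length
`√d`. -/
theorem vandermonde_mul_conjTranspose (d : ℕ) (hd : 1 ≤ d) :
    Matrix.vandermonde (fun j : Fin d => omegaPow d ((j : ℕ) + 1 : ℕ)) *
      (Matrix.vandermonde (fun j : Fin d => omegaPow d ((j : ℕ) + 1 : ℕ))).conjTranspose =
      (d : ℂ) • (1 : Matrix (Fin d) (Fin d) ℂ) := by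
  have hprim := omegaPow_one_isPrimitiveRoot d hd
  ext i j
  have hj0 : omegaPow d ((j : ℕ) + 1 : ℕ) ≠ 0 := exp_ne_zero _
  set x := omegaPow d ((i : ℕ) + 1 : ℕ) / omegaPow d ((j : ℕ) + 1 : ℕ) with hx
  have hentry : (Matrix.vandermonde (fun j : Fin d => omegaPow d ((j : ℕ) + 1 : ℕ)) *
      (Matrix.vandermonde (fun j : Fin d => omegaPow d ((j : ℕ) + 1 : ℕ))).conjTranspose) i j =
      ∑ k ∈ Finset.range d, x ^ k := by
    rw [Matrix.mul_apply, ← Fin.sum_univ_eq_sum_range]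
    refine Finset.sum_congr rfl fun k _ => ?_
    rw [Matrix.conjTranspose_apply, Matrix.vandermonde_apply, Matrix.vandermonde_apply, star_pow,
      ← mul_pow]
    congr 1
    rw [hx, div_eq_mul_inv, ← conj_omegaPow_natCast]
    rfl
  rw [hentry, Matrix.smul_apply, Matrix.one_apply, smul_eq_mul, mul_ite, mul_one, mul_zero]
  split_ifs with h
  · subst h
    rw [hx, div_self hj0]
    simp
  · have hx1 : x ≠ 1 := by
      intro h1
      rw [hx, div_eq_one_iff_eq hj0, omegaPow_natCast, omegaPow_natCast d ((j : ℕ) + 1), pow_succ,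
        pow_succ] at h1
      exact h (Fin.ext (hprim.pow_inj i.2 j.2
        (mul_right_cancel₀ (exp_ne_zero _ : omegaPow d 1 ≠ 0) h1)))
    have hxd : x ^ d = 1 := by
      rw [hx, div_pow, omegaPow_pow_self d hd, omegaPow_pow_self d hd, div_one]
    rw [geom_sum_eq hx1, hxd, sub_self, zero_div]

theorem norm_det_vandermonde (d : ℕ) (hd : 1 ≤ d) :
    ‖(Matrix.vandermonde (fun j : Fin d => omegaPow d ((j : ℕ) + 1 : ℕ))).det‖ =
      (d : ℝ) ^ ((d : ℝ) / 2) := by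
  have h := congrArg Matrix.det (vandermonde_mul_conjTranspose d hd)
  rw [Matrix.det_mul, Matrix.det_conjTranspose, Matrix.det_smul, Matrix.det_one, mul_one,
    Fintype.card_fin] at h
  have h2 := congrArg norm h
  rw [norm_mul, norm_star, norm_pow, norm_natCast, ← sq] at h2
  refine (pow_left_inj₀ (norm_nonneg _) (by positivity) two_ne_zero).1 ?_
  rw [h2, ← Real.rpow_natCast _ 2, ← Real.rpow_mul (Nat.cast_nonneg d), ← Real.rpow_natCast]
  congr 1
  push_cast
  ring

theorem sum_pairs (d : ℕ) (c : ℂ) :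
    ∑ i : Fin d, ∑ j ∈ Finset.Ioi i, (((i : ℕ) : ℂ) + ((j : ℕ) : ℂ) + c) =
      (d : ℂ) * ((d : ℂ) - 1) / 2 * ((d : ℂ) - 1 + c) := by
  induction d generalizing c with
  | zero => simp
  | succ d ih =>
    rw [Fin.sum_univ_succ, Fin.sum_Ioi_zero]
    simp only [Fin.sum_Ioi_succ]
    have h : ∀ i j : Fin d, (((i.succ : Fin (d + 1)) : ℕ) : ℂ) + (((j.succ : Fin (d + 1)) : ℕ) : ℂ)
        + c = ((i : ℕ) : ℂ) + ((j : ℕ) : ℂ) + (c + 2) := fun i j => by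
      simp only [Fin.val_succ]; push_cast; ring
    simp only [h, ih]
    have hs : ∑ j : Fin d, ((((0 : Fin (d + 1)) : ℕ) : ℂ) + (((j.succ : Fin (d + 1)) : ℕ) : ℂ) + c)
        = d * (d - 1) / 2 + d * (1 + c) := by
      have hg : ∀ n : ℕ, ∑ j ∈ Finset.range n, ((j : ℂ) + (1 + c)) =
          n * (n - 1) / 2 + n * (1 + c) := fun n => by
        induction n with
        | zero => simp
        | succ n ihn => rw [Finset.sum_range_succ, ihn]; push_cast; ring
      rw [← hg, ← Fin.sum_univ_eq_sum_range (fun j : ℕ => (j : ℂ) + (1 + c))]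
      refine Finset.sum_congr rfl fun j _ => ?_
      simp only [Fin.val_succ, Fin.val_zero]
      push_cast
      ring
    rw [hs]
    push_cast
    ring

/-- For real `x < y < x + d` this writes the difference as a phase times a positive sine. -/
theorem omegaPow_sub_omegaPow (d : ℕ) (x y : ℂ) :
    omegaPow d y - omegaPow d x =
      Complex.exp (Real.pi * I * (1 / 2 + (x + y) / d)) *
        (2 * Complex.sin (Real.pi * (y - x) / d)) := by
  have hI : Complex.exp (Real.pi * I * (1 / 2)) = I := by
    rw [show (Real.pi : ℂ) * I * (1 / 2) = Real.pi / 2 * I by ring, exp_pi_div_two_mul_I]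
  rw [mul_add, Complex.exp_add, hI, Complex.sin, omegaPow, omegaPow,
    show 2 * (Real.pi : ℂ) * I / d * y =
      Real.pi * I * ((x + y) / d) + Real.pi * (y - x) / d * I by ring,
    show 2 * (Real.pi : ℂ) * I / d * x =
      Real.pi * I * ((x + y) / d) + -(Real.pi * (y - x) / d) * I by ring,
    Complex.exp_add, Complex.exp_add]
  ring_nf
  rw [I_sq]
  ring

theorem det_vandermonde_omegaPow (d : ℕ) (hd : 1 ≤ d) :
    (Matrix.vandermonde (fun j : Fin d => omegaPow d ((j : ℕ) + 1 : ℕ))).det =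
      (-I) ^ ((d - 1) * (d - 2) / 2) * (((d : ℝ) ^ ((d : ℝ) / 2) : ℝ) : ℂ) := by
  have hd0 : (0 : ℝ) < d := by exact_mod_cast hd
  have hdC : (d : ℂ) ≠ 0 := by exact_mod_cast hd0.ne'
  -- The product of the positive sines; it is the modulus of the determinant.
  set r : ℝ := ∏ i : Fin d, ∏ j ∈ Finset.Ioi i,
    (2 * Real.sin (Real.pi * (((j : ℕ) : ℝ) - ((i : ℕ) : ℝ)) / d)) with hr
  have hr0 : 0 ≤ r := by
    refine Finset.prod_nonneg fun i _ => Finset.prod_nonneg fun j hj => ?_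
    have hij : ((i : ℕ) : ℝ) < ((j : ℕ) : ℝ) := by exact_mod_cast Finset.mem_Ioi.1 hj
    have hjd : ((j : ℕ) : ℝ) < d := by exact_mod_cast j.2
    have hi0 : (0 : ℝ) ≤ ((i : ℕ) : ℝ) := Nat.cast_nonneg _
    refine mul_nonneg zero_le_two (Real.sin_nonneg_of_nonneg_of_le_pi ?_ ?_)
    · exact div_nonneg (mul_nonneg Real.pi_pos.le (by linarith)) hd0.le
    · rw [div_le_iff₀ hd0]
      exact mul_le_mul_of_nonneg_left (by linarith) Real.pi_pos.le
  -- The phases multiply to a power of `-i`.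
  have hexp : Real.pi * I * ∑ i : Fin d, ∑ j ∈ Finset.Ioi i,
      (1 / 2 + ((((i : ℕ) + 1 : ℕ) : ℂ) + (((j : ℕ) + 1 : ℕ) : ℂ)) / d) =
      ((((d - 1) * (d - 2) / 2 : ℕ)) : ℂ) * (-(Real.pi / 2 * I)) +
        ((d * (d - 1) / 2 : ℕ) : ℂ) * (2 * Real.pi * I) := by
    have h1 : ∀ i j : Fin d, 1 / 2 + ((((i : ℕ) + 1 : ℕ) : ℂ) + (((j : ℕ) + 1 : ℕ) : ℂ)) / (d : ℂ) =
        (((i : ℕ) : ℂ) + ((j : ℕ) : ℂ) + (2 + d / 2)) / d := fun i j => by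
      push_cast; field_simp; ring
    simp only [h1, ← Finset.sum_div, sum_pairs]
    have h2 : ((((d - 1) * (d - 2) / 2 : ℕ)) : ℂ) = ((d : ℂ) - 1) * ((d : ℂ) - 2) / 2 := by
      obtain rfl | ⟨m, rfl⟩ : d = 1 ∨ ∃ m, d = m + 2 := by
        rcases Nat.lt_or_ge d 2 with h | h
        · left; omega
        · exact Or.inr ⟨d - 2, by omega⟩
      · simp
      · rw [show m + 2 - 1 = m + 1 by omega, Nat.add_sub_cancel, Nat.cast_div
          (by rw [mul_comm]; exact (Nat.even_mul_succ_self m).two_dvd) (by norm_num)]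
        push_cast
        ring
    have h3 : ((d * (d - 1) / 2 : ℕ) : ℂ) = (d : ℂ) * ((d : ℂ) - 1) / 2 := by
      rw [Nat.cast_div (Nat.even_mul_pred_self d).two_dvd (by norm_num), Nat.cast_mul,
        Nat.cast_sub hd]
      simp
    rw [h2, h3]
    field_simp
    ring
  have hphase : ∏ i : Fin d, ∏ j ∈ Finset.Ioi i, Complex.exp (Real.pi * I *
      (1 / 2 + ((((i : ℕ) + 1 : ℕ) : ℂ) + (((j : ℕ) + 1 : ℕ) : ℂ)) / d)) =
      (-I) ^ ((d - 1) * (d - 2) / 2) := by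
    simp only [← Complex.exp_sum, ← Finset.mul_sum]
    rw [hexp, Complex.exp_add, Complex.exp_nat_mul, Complex.exp_nat_mul_two_pi_mul_I, mul_one,
      Complex.exp_neg, exp_pi_div_two_mul_I, inv_I]
  have hdet : (Matrix.vandermonde (fun j : Fin d => omegaPow d ((j : ℕ) + 1 : ℕ))).det =
      (-I) ^ ((d - 1) * (d - 2) / 2) * (r : ℂ) := by
    rw [Matrix.det_vandermonde, ← hphase, hr]
    push_cast
    simp only [← Finset.prod_mul_distrib]
    refine Finset.prod_congr rfl fun i _ => Finset.prod_congr rfl fun j _ => ?_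
    rw [omegaPow_sub_omegaPow]
    congr 4
    ring
  have hnorm := norm_det_vandermonde d hd
  rw [hdet, norm_mul, norm_pow, norm_neg, norm_I, one_pow, one_mul, norm_real,
    Real.norm_of_nonneg hr0] at hnorm
  rw [hdet, hnorm]

/-! ### The determinant at `a = 0` -/


theorem mellin_rayExp_zero (d : ℕ) (hd : 1 ≤ d) (k : ℕ) {s : ℂ} (hs : 0 < s.re) :
    mellin (rayExp d 0 k) s = (d : ℂ) ^ (s / d - 1) * Gamma (s / d) := by
  have hd0 : (0 : ℝ) < d := by exact_mod_cast hd
  have hdC : (d : ℂ) ≠ 0 := by exact_mod_cast hd0.ne'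
  have hsd : 0 < (s / d).re := by
    rw [div_natCast_re]; positivity
  have hfun : ∀ u : ℝ, rayExp d 0 k u = (fun t : ℝ => Complex.exp (-(((1 / d : ℝ) : ℂ) * t)))
      (u ^ (d : ℝ)) := by
    intro u
    rw [rayExp, eval_P₀, mul_pow, omegaPow_pow_self d hd, Real.rpow_natCast]
    congr 1
    push_cast
    simp
    ring
  rw [funext hfun,
    mellin_comp_rpow (fun t : ℝ => Complex.exp (-(((1 / d : ℝ) : ℂ) * t))), abs_of_pos hd0,
    ofReal_natCast, mellin]
  simp only [smul_eq_mul]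
  rw [integral_cpow_mul_exp_neg_mul_Ioi hsd (by positivity), cpow_sub _ _ hdC, cpow_one, real_smul]
  push_cast
  rw [one_div_one_div]
  ring

/-- At `a = 0` the Omega functions are Gamma functions. -/
theorem Omega_zero_eq (d : ℕ) (hd : 1 ≤ d) (k : ℕ) {s : ℂ} (hs : ∀ m : ℕ, s ≠ -(m : ℂ)) :
    Omega d 0 k s = omegaPow d (k * s) * ((d : ℂ) ^ (s / d - 1) * Gamma (s / d)) := by
  have hd0 : (0 : ℝ) < d := by exact_mod_cast hd
  have hdC : (d : ℂ) ≠ 0 := by exact_mod_cast hd0.ne'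
  obtain ⟨n, hn⟩ := exists_nat_gt (-s.re)
  induction n generalizing s with
  | zero =>
    have hs0 : 0 < s.re := by simpa using hn
    rw [Omega_eq_rayIntegral d 0 k hs0, rayIntegral_eq, mellin_rayExp_zero d hd k hs0]
  | succ n ih =>
    have hs0 : s ≠ 0 := by simpa using hs 0
    have h := ih (s := s + d) (fun m hm => hs (m + d) (by push_cast; linear_combination hm)) (by
      have : (1 : ℝ) ≤ d := by exact_mod_cast hd
      simp only [add_re, natCast_re]
      push_cast at hn
      linarith)
    have hf := Omega_functional d hd 0 k hs0
    simp only [Pi.zero_apply, mul_zero, zero_mul, Finset.sum_const_zero, sub_zero] at hf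
    have hsd : (s + d) / d = s / d + 1 := by field_simp
    have hw : omegaPow d (k * (s + d)) = omegaPow d (k * s) := by
      rw [mul_add, omegaPow_add, omegaPow_mul_nat, omegaPow_pow_self d hd, mul_one]
    rw [h, hw, hsd, Gamma_add_one _ (div_ne_zero hs0 hdC), add_sub_cancel_right] at hf
    refine mul_left_cancel₀ hs0 (hf.trans ?_)
    rw [cpow_sub _ _ hdC, cpow_one]
    field_simp

theorem Delta_zero_eq_mul_det_vandermonde (d : ℕ) (hd : 1 ≤ d) {s : ℂ}
    (hs : ∀ n : ℕ, s ≠ -((n : ℂ) + 1)) :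
    Delta d 0 s = (∏ k : Fin d, omegaPow d (((k : ℕ) : ℂ) * s)) *
      (∏ l : Fin d, ((d : ℂ) ^ ((s + ((l : ℕ) : ℂ) + 1) / d - 1) *
        Gamma ((s + ((l : ℕ) : ℂ) + 1) / d))) *
      (Matrix.vandermonde (fun j : Fin d => omegaPow d ((j : ℕ) + 1 : ℕ))).det := by
  rw [← Matrix.det_transpose (Matrix.vandermonde _), mul_assoc, ← Matrix.det_mul_row,
    ← Matrix.det_mul_column, Delta]
  congr 1
  ext k l
  have hsl : ∀ m : ℕ, s + ((l : ℕ) : ℂ) + 1 ≠ -(m : ℂ) := fun m h =>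
    hs (m + l) (by push_cast; linear_combination h)
  have hw : omegaPow d (((k : ℕ) : ℂ) * (s + ((l : ℕ) : ℂ) + 1)) =
      omegaPow d (((k : ℕ) : ℂ) * s) * omegaPow d ((l : ℕ) + 1 : ℕ) ^ (k : ℕ) := by
    rw [← omegaPow_mul_nat, ← omegaPow_add]
    push_cast
    ring_nf
  simp only [omegaMatrix, Matrix.of_apply, Matrix.transpose_apply, Matrix.vandermonde_apply]
  rw [Omega_zero_eq d hd k hsl, hw]
  ring

theorem prod_omegaPow_mul (d : ℕ) (s : ℂ) :
    ∏ k : Fin d, omegaPow d (((k : ℕ) : ℂ) * s) = omegaPow d ((d : ℂ) * ((d : ℂ) - 1) / 2 * s) := by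
  have h : ∀ n : ℕ, ∏ k ∈ Finset.range n, omegaPow d ((k : ℂ) * s) =
      omegaPow d ((n : ℂ) * ((n : ℂ) - 1) / 2 * s) := by
    intro n
    induction n with
    | zero => simp [omegaPow]
    | succ n ih =>
      rw [Finset.prod_range_succ, ih, ← omegaPow_add]
      push_cast
      ring_nf
  rw [Fin.prod_univ_eq_prod_range (fun k => omegaPow d ((k : ℂ) * s)), h]

/-- The evaluation at `a = 0`: the Gauss multiplication formula for the Gamma factors, and the
Vandermonde determinant of the roots of unity. -/
theorem Delta_zero_eq (d : ℕ) (hd : 1 ≤ d) {s : ℂ} (hs : ∀ n : ℕ, s ≠ -((n : ℂ) + 1)) :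
    Delta d 0 s =
      (-I) ^ ((d - 1) * (d - 2) / 2) *
        (((2 * Real.pi) ^ ((d : ℝ) / 2) / Real.sqrt (2 * Real.pi) : ℝ) : ℂ) *
        omegaPow d ((d : ℂ) * ((d : ℂ) - 1) / 2 * s) * Gamma (s + 1) := by
  rw [Delta_zero_eq_mul_det_vandermonde d hd hs, prod_omegaPow_mul, det_vandermonde_omegaPow d hd]
  obtain ⟨m, rfl⟩ : ∃ m, d = m + 1 := ⟨d - 1, by omega⟩
  have hm : (0 : ℝ) < (m : ℝ) + 1 := by positivity
  have hmC : (m : ℂ) + 1 ≠ 0 := by exact_mod_cast hm.ne'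
  have hprod : ∏ l : Fin (m + 1), (((m + 1 : ℕ) : ℂ) ^ ((s + ((l : ℕ) : ℂ) + 1) / ((m + 1 : ℕ) : ℂ)
        - 1) * Gamma ((s + ((l : ℕ) : ℂ) + 1) / ((m + 1 : ℕ) : ℂ))) =
      ((m : ℂ) + 1) ^ (s + 1 + m / 2 - (m + 1)) *
        (((√(2 * Real.pi) ^ m * √((m : ℝ) + 1) : ℝ) : ℂ) *
          (((1 / ((m : ℝ) + 1) : ℝ)) : ℂ) ^ (s + 1) * Gamma (s + 1)) := by
    rw [← prod_Gamma_add_div, Finset.prod_mul_distrib]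
    push_cast
    rw [prod_cpow_eq_cpow_sum _ _ hmC, Finset.sum_sub_distrib,
      Fin.sum_univ_eq_sum_range (fun l => (s + (l : ℂ) + 1) / ((m : ℂ) + 1)),
      Fin.prod_univ_eq_prod_range (fun l => Gamma ((s + (l : ℂ) + 1) / ((m : ℂ) + 1)))]
    simp only [add_right_comm s _ (1 : ℂ), sum_range_add_div]
    simp
  have hpi : (2 * Real.pi) ^ (((m + 1 : ℕ) : ℝ) / 2) / √(2 * Real.pi) = √(2 * Real.pi) ^ m := by
    rw [div_eq_iff (by positivity), ← pow_succ, Real.sqrt_eq_rpow, ← Real.rpow_natCast,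
      ← Real.rpow_mul (by positivity)]
    congr 1
    ring
  -- The powers of `d` cancel.
  have hpow : ((m : ℂ) + 1) ^ (s + 1 + m / 2 - (m + 1)) * ((√((m : ℝ) + 1) : ℝ) : ℂ) *
      (((1 / ((m : ℝ) + 1) : ℝ)) : ℂ) ^ (s + 1) *
      (((((m + 1 : ℕ) : ℝ) ^ (((m + 1 : ℕ) : ℝ) / 2) : ℝ)) : ℂ) = 1 := by
    have e1 : ((√((m : ℝ) + 1) : ℝ) : ℂ) = ((m : ℂ) + 1) ^ (1 / 2 : ℂ) := by
      rw [Real.sqrt_eq_rpow, ofReal_cpow hm.le]; push_cast; rfl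
    have e2 : (((1 / ((m : ℝ) + 1) : ℝ)) : ℂ) ^ (s + 1) = ((m : ℂ) + 1) ^ (-(s + 1)) := by
      have harg : ((m : ℂ) + 1).arg ≠ Real.pi := by
        rw [show (m : ℂ) + 1 = (((m : ℝ) + 1 : ℝ) : ℂ) by push_cast; rfl,
          arg_ofReal_of_nonneg hm.le]
        exact Real.pi_pos.ne
      push_cast
      rw [one_div, inv_cpow _ _ harg, cpow_neg]
    have e3 : (((((m + 1 : ℕ) : ℝ) ^ (((m + 1 : ℕ) : ℝ) / 2) : ℝ)) : ℂ) =
        ((m : ℂ) + 1) ^ (((m : ℂ) + 1) / 2) := by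
      rw [ofReal_cpow (by positivity)]; push_cast; rfl
    rw [e1, e2, e3, ← cpow_add _ _ hmC, ← cpow_add _ _ hmC, ← cpow_add _ _ hmC]
    convert cpow_zero ((m : ℂ) + 1) using 2
    ring
  rw [hprod, hpi, ofReal_mul]
  linear_combination (omegaPow (m + 1) (((m + 1 : ℕ) : ℂ) * (((m + 1 : ℕ) : ℂ) - 1) / 2 * s) *
    (((√(2 * Real.pi) ^ m : ℝ)) : ℂ) * Gamma (s + 1) *
      (-I) ^ ((m + 1 - 1) * (m + 1 - 2) / 2)) * hpow

theorem Delta_zero_ne_zero (d : ℕ) (hd : 1 ≤ d) {s : ℂ} (hs : ∀ n : ℕ, s ≠ -((n : ℂ) + 1)) :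
    Delta d 0 s ≠ 0 := by
  rw [Delta_zero_eq d hd hs]
  refine mul_ne_zero (mul_ne_zero (mul_ne_zero (pow_ne_zero _ (neg_ne_zero.2 I_ne_zero)) ?_)
    (exp_ne_zero _)) (Gamma_ne_zero fun m h => hs m (by linear_combination h))
  exact ofReal_ne_zero.2 (by positivity)

end OmegaFunction

theorem mainTheorem2 (d : ℕ) (hd : 1 ≤ d) :
    (∀ (a : Fin (d - 1) → ℂ) (s : ℂ), (∀ n : ℕ, s ≠ -((n : ℂ) + 1)) →
      LinearIndependent ℂ
          (fun l : Fin d => fun k : Fin d =>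
            OmegaFunction.Omega d a (k : ℕ) (s + ((l : ℕ) : ℂ) + 1)) ∧
        OmegaFunction.Delta d a s ≠ 0) ∧
    (∃ Pi_d : MvPolynomial (Option (Fin (d - 1))) ℚ,
      ∀ (a : Fin (d - 1) → ℂ) (s : ℂ), (∀ n : ℕ, s ≠ -((n : ℂ) + 1)) →
        OmegaFunction.Delta d a s =
          OmegaFunction.Delta d 0 s *
            Complex.exp (MvPolynomial.aeval (fun i : Option (Fin (d - 1)) => i.elim s a) Pi_d)) ∧
    (∀ s : ℂ, (∀ n : ℕ, s ≠ -((n : ℂ) + 1)) →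
      OmegaFunction.Delta d 0 s =
        (-Complex.I) ^ ((d - 1) * (d - 2) / 2) *
          (((2 * Real.pi) ^ ((d : ℝ) / 2) / Real.sqrt (2 * Real.pi) : ℝ) : ℂ) *
          OmegaFunction.omegaPow d ((d : ℂ) * ((d : ℂ) - 1) / 2 * s) *
          Complex.Gamma (s + 1)) := by
  obtain ⟨Pi_d, hPi⟩ := OmegaFunction.exists_Delta_eq_mul_exp d hd
  have hne : ∀ (a : Fin (d - 1) → ℂ) (s : ℂ), (∀ n : ℕ, s ≠ -((n : ℂ) + 1)) →
      OmegaFunction.Delta d a s ≠ 0 := fun a s hs => by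
    rw [hPi a s hs]
    exact mul_ne_zero (OmegaFunction.Delta_zero_ne_zero d hd hs) (Complex.exp_ne_zero _)
  refine ⟨fun a s hs => ⟨?_, hne a s hs⟩, ⟨Pi_d, hPi⟩,
    fun s hs => OmegaFunction.Delta_zero_eq d hd hs⟩
  exact Matrix.linearIndependent_cols_of_det_ne_zero (hne a s hs)
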